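/- Let $d\ge 0$, let $h:\mathbb{R}^d\to\{\text{subsets of }\mathbb{R}^d\}$, and let $x_n$, $y_n$ $(n\ge 0)$ and $M_n$ $(n\ge 1)$ be $\mathbb{R}^d$-valued random variables on a probability space such that almost surely, for all $n\ge 0$, $$x_{n+1}=x_n+a(n)\,[\,y_n+M_{n+1}\,],\qquad y_n\in h(x_n).$$ For $c\ge 1$ and $x\in\mathbb{R}^d$ put $h_c(x)=\{y : cy\in h(cx)\}$, and let $h_\infty(x)$ be the closure of the lower limit $\{y : \lim_{c\to\infty} d(y,h_c(x))=0\}$, where $c\to\infty$ through the reals, $d(y,S)=\inf_{z\in S}\|y-z\|$ and $d(y,\emptyset)=\infty$. Assume: * **(A1)** $h$ is a Marchaud map: each $h(x)$ is convex and compact; there is $K>0$ with $\|w\|<K(1+\|x\|)$ for all $x$ and all $w\in h(x)$; and the graph $\{(x,y): y\in h(x)\}$ is closed. * **(A2)** $a(n)>0$ for all $n\ge0$, $\sum_n a(n)=\infty$ and $\sum_n a(n)^2<\infty$. * **(A3)** $(M_n)_{n\ge1}$ is a square integrable martingale difference sequence with respect to $\mathcal F_n=\sigma(x_0,M_1,\dots,M_n)$,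 that is, $E[M_{n+1}\mid\mathcal F_n]=0$ a.s. for $n\ge 0$, and there is $K>0$ with $E[\|M_{n+1}\|^2\mid\mathcal F_n]\le K(1+\|x_n\|^2)$ a.s. for all $n\ge0$. * **(A4)** $h_\infty(x)\ne\emptyset$ for all $x$, and the differential inclusion $\dot x(t)\in h_\infty(x(t))$ has an attracting set $\mathcal A\subseteq\{\|x\|<1\}$ with a fundamental neighborhood containing $\{\|x\|\le 1\}$. That is, $\mathcal A$ is compact and has a neighborhood $U\supseteq\{\|x\|\le1\}$ such that for every $\varepsilon>0$ there is $T\ge0$ for which every solution $\mathbf x$ with $\mathbf x(0)\in U$ satisfies $d(\mathbf x(t),\mathcal A)<\varepsilon$ for all $t\ge T$. A solution is a map $\mathbf x:[0,\infty)\to\mathbb{R}^d$, absolutely continuous on compact intervals, with $\dot{\mathbf x}(t)\in h_\infty(\mathbf x(t))$ for almost every $t\ge 0$. * **(A5)** If $1\le c_1<c_2<\cdots$ are integers, $u_n\to u$ and $v_n\to v$ in $\mathbb{R}^d$, and $v_n\in h_{c_n}(u_n)$ for all $n$, then $v\in h_\infty(u)$. Then $\sup_n\|x_n\|<\infty$ almost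 surely. -/

import Mathlib

open Filter MeasureTheory
open scoped Topology

/-- Marchaud map: convex compact values, linear growth with one constant, closed graph. -/
structure IsMarchaud {d : ℕ}
    (h : EuclideanSpace ℝ (Fin d) → Set (EuclideanSpace ℝ (Fin d))) : Prop where
  convex : ∀ x, Convex ℝ (h x)
  isCompact : ∀ x, IsCompact (h x)
  bounded : ∃ K : ℝ, 0 < K ∧ ∀ x, ∀ w ∈ h x, ‖w‖ < K * (1 + ‖x‖)
  isClosed_graph :
    IsClosed {p : EuclideanSpace ℝ (Fin d) × EuclideanSpace ℝ (Fin d) | p.2 ∈ h p.1}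

/-- `h_c(x) = {y | c y ∈ h(c x)}`. -/
def scaledMap {d : ℕ} (h : EuclideanSpace ℝ (Fin d) → Set (EuclideanSpace ℝ (Fin d)))
    (c : ℝ) (x : EuclideanSpace ℝ (Fin d)) : Set (EuclideanSpace ℝ (Fin d)) :=
  {y | c • y ∈ h (c • x)}

/-- Lower limit of the sets `S c` as the real number `c` tends to infinity: the points `y` with
`d(y, S c) → 0`. The distance to the empty set is `∞`. -/
def lowerLimit {d : ℕ} (S : ℝ → Set (EuclideanSpace ℝ (Fin d))) :
    Set (EuclideanSpace ℝ (Fin d)) :=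
  {y | Tendsto (fun c : ℝ => Metric.infEDist y (S c)) atTop (𝓝 0)}

/-- `h_∞(x)`: the closure of the lower limit of `h_c(x)` as `c → ∞`. -/
def limitMap {d : ℕ} (h : EuclideanSpace ℝ (Fin d) → Set (EuclideanSpace ℝ (Fin d)))
    (x : EuclideanSpace ℝ (Fin d)) : Set (EuclideanSpace ℝ (Fin d)) :=
  closure (lowerLimit fun c => scaledMap h c x)

/-- `φ` is a solution on `[0, ∞)` of `φ' ∈ H(φ)`: absolutely continuous on compact intervals, with
the inclusion at almost every time. Values of `φ` at negative times are irrelevant. -/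
structure IsDISolution {d : ℕ}
    (H : EuclideanSpace ℝ (Fin d) → Set (EuclideanSpace ℝ (Fin d)))
    (φ : ℝ → EuclideanSpace ℝ (Fin d)) : Prop where
  absolutelyContinuous : ∀ b : ℝ, 0 ≤ b → AbsolutelyContinuousOnInterval φ 0 b
  deriv_mem : ∀ᵐ t ∂(volume.restrict (Set.Ioi (0 : ℝ))),
    DifferentiableAt ℝ φ t ∧ deriv φ t ∈ H (φ t)

/-- The set-valued semiflow `Φ_t(x)` of `φ' ∈ H(φ)`. -/
def semiflow {d : ℕ} (H : EuclideanSpace ℝ (Fin d) → Set (EuclideanSpace ℝ (Fin d)))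
    (t : ℝ) (x : EuclideanSpace ℝ (Fin d)) : Set (EuclideanSpace ℝ (Fin d)) :=
  {z | ∃ φ : ℝ → EuclideanSpace ℝ (Fin d), IsDISolution H φ ∧ φ 0 = x ∧ φ t = z}

/-- `A` is an attracting set of `φ' ∈ H(φ)` with fundamental neighborhood `U`. -/
structure IsAttractingSet {d : ℕ}
    (H : EuclideanSpace ℝ (Fin d) → Set (EuclideanSpace ℝ (Fin d)))
    (A U : Set (EuclideanSpace ℝ (Fin d))) : Prop where
  isCompact : IsCompact A
  nhds : U ∈ 𝓝ˢ A
  attracts : ∀ ε : ℝ, 0 < ε → ∃ T : ℝ, 0 ≤ T ∧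
    (⋃ t ∈ Set.Ici T, ⋃ x ∈ U, semiflow H t x) ⊆ Metric.thickening ε A

/-- The σ-algebra generated by `x₀, M₁, …, Mₙ`. -/
@[reducible] def noiseSigma {d : ℕ} {Ω : Type*} (x₀ : Ω → EuclideanSpace ℝ (Fin d))
    (M : ℕ → Ω → EuclideanSpace ℝ (Fin d)) (n : ℕ) : MeasurableSpace Ω :=
  MeasurableSpace.comap x₀ inferInstance ⊔
    ⨆ i ∈ Set.Icc 1 n, MeasurableSpace.comap (M i) inferInstance

/-- `M₁, M₂, …` is a square integrable martingale difference sequence with respect to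
`σ(x₀, M₁, …, Mₙ)`, `n ≥ 0`. The entry `M 0` plays no role. -/
structure IsMartingaleDifference {d : ℕ} {Ω : Type*} [MeasurableSpace Ω] (μ : Measure Ω)
    (x₀ : Ω → EuclideanSpace ℝ (Fin d)) (M : ℕ → Ω → EuclideanSpace ℝ (Fin d)) : Prop where
  measurable_init : Measurable x₀
  measurable : ∀ n, Measurable (M (n + 1))
  memLp : ∀ n, MemLp (M (n + 1)) 2 μ
  condExp_eq_zero : ∀ n, μ[M (n + 1) | noiseSigma x₀ M n] =ᵐ[μ] 0

/-!
Suppose a path of the recursion is unbounded. At a record time, divide the path by the record norm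
and look at it from a time `T` earlier, on the time scale of the step sizes. By a discrete Gronwall
inequality these rescaled paths stay bounded on bounded time intervals, so they converge pointwise
along an ultrafilter. Over a short time interval, the increment of a rescaled path is, up to noise,
the elapsed time times a weighted average of rescaled drifts. Hence the limit curve `X` is locally
Lipschitz and solves the limiting inclusion `X' ∈ h_∞(X)`. At a record no earlier state is larger,
so `‖X 0‖ ≤ 1 = ‖X T‖`, whereas for suitable `T` every solution starting in the closed unit ball
lies in the open unit ball at time `T`.

The noise is negligible at this scale: divided by a running maximum of its conditional standard
deviations it has an almost surely convergent sum, by `L²`-bounded martingale convergence.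
Summation by parts then bounds its tail sums by a small multiple of that maximum, hence of the
running maximum of `1 + ‖x_n‖`.
-/

open scoped NNReal

/-! ### The limit map -/

section LimitMap

variable {d : ℕ}

theorem mem_lowerLimit_iff {S : ℝ → Set (EuclideanSpace ℝ (Fin d))}
    {y : EuclideanSpace ℝ (Fin d)} :
    y ∈ lowerLimit S ↔ ∀ ε : ℝ, 0 < ε → ∀ᶠ c in atTop, y ∈ Metric.thickening ε (S c) := by
  simp only [Metric.mem_thickening_iff_infEDist_lt]
  refine ENNReal.tendsto_nhds_zero.trans ⟨fun hy ε hε => ?_, fun hy ε hε => ?_⟩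
  · filter_upwards [hy (ENNReal.ofReal (ε / 2)) (by simpa using hε)] with c hc
    exact hc.trans_lt ((ENNReal.ofReal_lt_ofReal_iff hε).2 (half_lt_self hε))
  · obtain ⟨δ, -, hδ0, hδε⟩ := ENNReal.lt_iff_exists_real_btwn.1 hε
    filter_upwards [hy δ (ENNReal.ofReal_pos.1 hδ0)] with c hc
    exact (hc.trans hδε).le

theorem convex_scaledMap {h : EuclideanSpace ℝ (Fin d) → Set (EuclideanSpace ℝ (Fin d))}
    (hh : ∀ u, Convex ℝ (h u)) (c : ℝ) (u : EuclideanSpace ℝ (Fin d)) :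
    Convex ℝ (scaledMap h c u) :=
  (hh (c • u)).smul_preimage c

theorem convex_lowerLimit {S : ℝ → Set (EuclideanSpace ℝ (Fin d))} (hS : ∀ c, Convex ℝ (S c)) :
    Convex ℝ (lowerLimit S) := by
  intro p hp q hq α β hα hβ hαβ
  rw [mem_lowerLimit_iff] at hp hq ⊢
  intro ε hε
  filter_upwards [hp ε hε, hq ε hε] with c hpc hqc
  exact (hS c).thickening ε hpc hqc hα hβ hαβ

theorem convex_limitMap {h : EuclideanSpace ℝ (Fin d) → Set (EuclideanSpace ℝ (Fin d))}
    (hh : ∀ u, Convex ℝ (h u)) (u : EuclideanSpace ℝ (Fin d)) : Convex ℝ (limitMap h u) :=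
  (convex_lowerLimit fun c => convex_scaledMap hh c u).closure

end LimitMap

section ScalingLimit

variable {E : Type*} [NormedAddCommGroup E] [NormedSpace ℝ E] {h G : E → Set E} {K : ℝ≥0}

/-- `G` contains every limit of selections of the rescaled set-valued maps
`u ↦ {v | c • v ∈ h (c • u)}` along integer scales `c` increasing to infinity. -/
def IsScalingLimit (h G : E → Set E) : Prop :=
  ∀ (c : ℕ → ℕ) (u v : ℕ → E) (p q : E), (∀ n, 1 ≤ c n) → StrictMono c →
    Tendsto u atTop (𝓝 p) → Tendsto v atTop (𝓝 q) →
    (∀ n, (c n : ℝ) • v n ∈ h ((c n : ℝ) • u n)) → q ∈ G p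

theorem norm_le_of_natCast_smul_mem (hK : ∀ u, ∀ w ∈ h u, ‖w‖ ≤ K * (1 + ‖u‖)) {c : ℕ}
    (hc : 1 ≤ c) {u v : E} (hv : (c : ℝ) • v ∈ h ((c : ℝ) • u)) : ‖v‖ ≤ K * (1 + ‖u‖) := by
  have hc' : (1 : ℝ) ≤ c := mod_cast hc
  have hcv : c * ‖v‖ ≤ K * (1 + c * ‖u‖) := by
    simpa only [norm_smul, Real.norm_natCast] using hK _ _ hv
  refine le_of_mul_le_mul_left ?_ (zero_lt_one.trans_le hc')
  calc c * ‖v‖ ≤ K * (c + c * ‖u‖) := hcv.trans (by gcongr)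
    _ = c * (K * (1 + ‖u‖)) := by ring

theorem IsScalingLimit.eventually_mem_cthickening [ProperSpace E] (hG : IsScalingLimit h G)
    (hK : ∀ u, ∀ w ∈ h u, ‖w‖ ≤ K * (1 + ‖u‖)) (z : E) {η : ℝ} (hη : 0 < η) :
    ∀ᶠ p : ℕ × E in atTop ×ˢ 𝓝 z, ∀ v, (p.1 : ℝ) • v ∈ h ((p.1 : ℝ) • p.2) →
      v ∈ Metric.cthickening η (G z) := by
  by_contra hcon
  have hfreq := (not_eventually.1 hcon).and_eventually
    ((eventually_ge_atTop 1).prod_mk (Metric.ball_mem_nhds z one_pos))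
  obtain ⟨p, hp, hpv⟩ := exists_seq_forall_of_frequently hfreq
  have hc : Tendsto (fun n => (p n).1) atTop atTop := tendsto_fst.comp hp
  have hu : Tendsto (fun n => (p n).2) atTop (𝓝 z) := tendsto_snd.comp hp
  choose v hv hvη using fun n => by simpa only [not_forall, exists_prop] using (hpv n).1
  have hv_mem : ∀ n, v n ∈ Metric.closedBall (0 : E) (K * (1 + (‖z‖ + 1))) := by
    intro n
    obtain ⟨hc1, hun⟩ := (hpv n).2
    have hun' : ‖(p n).2‖ ≤ ‖z‖ + 1 :=
      norm_le_norm_add_const_of_dist_le (Metric.mem_ball.1 hun).le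
    rw [mem_closedBall_zero_iff]
    exact (norm_le_of_natCast_smul_mem hK hc1 (hv n)).trans (by gcongr)
  obtain ⟨φ, hφ, hcφ⟩ := strictMono_subseq_of_tendsto_atTop hc
  obtain ⟨q, -, ψ, hψ, hq⟩ := tendsto_subseq_of_bounded Metric.isBounded_closedBall
    fun n => hv_mem (φ n)
  have hq_mem : q ∈ G z :=
    hG _ _ _ z q (fun n => (hpv (φ (ψ n))).2.1) (hcφ.comp hψ)
      (hu.comp (hφ.comp hψ).tendsto_atTop) hq fun n => hv (φ (ψ n))
  obtain ⟨n, hn⟩ := (hq.eventually (Metric.ball_mem_nhds q hη)).exists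
  exact hvη _ (Metric.mem_cthickening_of_dist_le _ q η _ hq_mem (le_of_lt hn))

end ScalingLimit

/-! ### Sums that are negligible against a monotone weight -/

section Negligible

variable {E : Type*} [NormedAddCommGroup E]

/-- The tail sums of `u` are asymptotically negligible against `g`: beyond a certain index, the
sum over any interval is at most `ε` times the value of `g` at the right end point. -/
def IsTailNegligible (u : ℕ → E) (g : ℕ → ℝ) : Prop :=
  ∀ ε : ℝ, 0 < ε → ∀ᶠ n in atTop, ∀ m ≥ n, ‖∑ j ∈ Finset.Ico n m, u j‖ ≤ ε * g m

theorem IsTailNegligible.mono {u : ℕ → E} {f g : ℕ → ℝ} (hu : IsTailNegligible u f) {C : ℝ}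
    (hC : 0 < C) (hfg : ∀ n, f n ≤ C * g n) : IsTailNegligible u g := by
  intro ε hε
  filter_upwards [hu (ε / C) (by positivity)] with n hn m hm
  calc _ ≤ ε / C * f m := hn m hm
    _ ≤ ε / C * (C * g m) := by gcongr; exact hfg m
    _ = ε * g m := by field_simp

variable [NormedSpace ℝ E]

theorem sum_Ico_smul_sub (g : ℕ → ℝ) (e : ℕ → E) {n m : ℕ} (hnm : n ≤ m) :
    ∑ j ∈ Finset.Ico n m, g j • (e (j + 1) - e j)
      = g m • e m - g n • e n - ∑ j ∈ Finset.Ico n m, (g (j + 1) - g j) • e (j + 1) := by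
  rw [← Finset.sum_Ico_sub (fun j => g j • e j) hnm, ← Finset.sum_sub_distrib]
  exact Finset.sum_congr rfl fun j _ => by module

theorem norm_sum_Ico_smul_sub_le {g : ℕ → ℝ} (hg : Monotone g) (hg0 : ∀ n, 0 ≤ g n) {e : ℕ → E}
    {δ : ℝ} {n m : ℕ} (hnm : n ≤ m) (he : ∀ j ≥ n, ‖e j‖ ≤ δ) :
    ‖∑ j ∈ Finset.Ico n m, g j • (e (j + 1) - e j)‖ ≤ 2 * δ * g m := by
  have hend : ∀ j ≥ n, ‖g j • e j‖ ≤ δ * g j := fun j hj => by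
    rw [norm_smul, Real.norm_of_nonneg (hg0 j), mul_comm]
    exact mul_le_mul_of_nonneg_right (he j hj) (hg0 j)
  have hsum : ‖∑ j ∈ Finset.Ico n m, (g (j + 1) - g j) • e (j + 1)‖ ≤ δ * (g m - g n) := by
    rw [← Finset.sum_Ico_sub g hnm, Finset.mul_sum]
    refine norm_sum_le_of_le _ fun j hj => ?_
    have hgj : 0 ≤ g (j + 1) - g j := sub_nonneg.2 (hg j.le_succ)
    rw [norm_smul, Real.norm_of_nonneg hgj, mul_comm]
    exact mul_le_mul_of_nonneg_right (he _ ((Finset.mem_Ico.1 hj).1.trans j.le_succ)) hgj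
  rw [sum_Ico_smul_sub g e hnm]
  calc _ ≤ ‖g m • e m‖ + ‖g n • e n‖
          + ‖∑ j ∈ Finset.Ico n m, (g (j + 1) - g j) • e (j + 1)‖ :=
        (norm_sub_le _ _).trans (by gcongr; exact norm_sub_le _ _)
    _ ≤ δ * g m + δ * g n + δ * (g m - g n) :=
        add_le_add (add_le_add (hend m hnm) (hend n le_rfl)) hsum
    _ = 2 * δ * g m := by ring

theorem isTailNegligible_of_tendsto_sum {g : ℕ → ℝ} (hg : Monotone g) (hg0 : ∀ n, 0 < g n)
    {u : ℕ → E} {l : E}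
    (hl : Tendsto (fun n => ∑ j ∈ Finset.range n, (g j)⁻¹ • u j) atTop (𝓝 l)) :
    IsTailNegligible u g := by
  intro ε hε
  have hsmall : ∀ᶠ j in atTop, ‖∑ i ∈ Finset.range j, (g i)⁻¹ • u i - l‖ ≤ ε / 2 :=
    (tendsto_iff_norm_sub_tendsto_zero.1 hl).eventually_le_const (half_pos hε)
  filter_upwards [eventually_forall_ge_atTop.2 hsmall] with n hn m hnm
  have hu : ∀ j, u j = g j • ((∑ i ∈ Finset.range (j + 1), (g i)⁻¹ • u i - l)
      - (∑ i ∈ Finset.range j, (g i)⁻¹ • u i - l)) := fun j => by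
    rw [sub_sub_sub_cancel_right, Finset.sum_range_succ_sub_sum, smul_inv_smul₀ (hg0 j).ne']
  rw [Finset.sum_congr rfl fun j _ => hu j]
  refine (norm_sum_Ico_smul_sub_le hg (fun n => (hg0 n).le) hnm hn).trans_eq ?_
  ring

end Negligible

/-! ### The time scale of the step sizes -/

/-- The time elapsed before step `n`. -/
def elapsed (a : ℕ → ℝ) (n : ℕ) : ℝ := ∑ j ∈ Finset.range n, a j

/-- The step during which time `τ` falls; it is `0` for negative `τ`. -/
noncomputable def stepAt (a : ℕ → ℝ) (τ : ℝ) : ℕ := sInf {n | τ < elapsed a (n + 1)}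

theorem elapsed_succ (a : ℕ → ℝ) (n : ℕ) : elapsed a (n + 1) = elapsed a n + a n :=
  Finset.sum_range_succ _ _

theorem sum_Ico_eq_elapsed_sub (a : ℕ → ℝ) {m n : ℕ} (hmn : m ≤ n) :
    ∑ j ∈ Finset.Ico m n, a j = elapsed a n - elapsed a m :=
  Finset.sum_Ico_eq_sub _ hmn

/-- Step sizes of an algorithm that runs through all times: positive, with divergent sum. -/
structure IsStepSequence (a : ℕ → ℝ) : Prop where
  pos : ∀ n, 0 < a n
  not_summable : ¬ Summable a

namespace IsStepSequence

variable {a : ℕ → ℝ}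

theorem strictMono_elapsed (ha : IsStepSequence a) : StrictMono (elapsed a) :=
  strictMono_nat_of_lt_succ fun n => by
    simpa only [elapsed_succ] using lt_add_of_pos_right _ (ha.pos n)

theorem tendsto_elapsed (ha : IsStepSequence a) : Tendsto (elapsed a) atTop atTop :=
  (not_summable_iff_tendsto_nat_atTop_of_nonneg fun n => (ha.pos n).le).1 ha.not_summable

theorem lt_elapsed_stepAt_succ (ha : IsStepSequence a) (τ : ℝ) :
    τ < elapsed a (stepAt a τ + 1) :=
  Nat.sInf_mem (s := {n | τ < elapsed a (n + 1)})
    (((tendsto_add_atTop_iff_nat 1).2 ha.tendsto_elapsed).eventually_gt_atTop τ).exists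

theorem stepAt_le_iff (ha : IsStepSequence a) {τ : ℝ} {n : ℕ} :
    stepAt a τ ≤ n ↔ τ < elapsed a (n + 1) :=
  ⟨fun hle => (ha.lt_elapsed_stepAt_succ τ).trans_le
    (ha.strictMono_elapsed.monotone (Nat.succ_le_succ hle)), fun hlt => Nat.sInf_le hlt⟩

theorem elapsed_le_of_lt_stepAt (ha : IsStepSequence a) {τ : ℝ} {n : ℕ} (hn : n < stepAt a τ) :
    elapsed a (n + 1) ≤ τ :=
  not_lt.1 fun hlt => hn.not_ge (ha.stepAt_le_iff.2 hlt)

theorem elapsed_stepAt_le (ha : IsStepSequence a) {τ : ℝ} (hτ : 0 ≤ τ) :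
    elapsed a (stepAt a τ) ≤ τ := by
  rcases hn : stepAt a τ with _ | n
  · simpa only [elapsed, Finset.sum_range_zero] using hτ
  · exact ha.elapsed_le_of_lt_stepAt (by omega)

theorem monotone_stepAt (ha : IsStepSequence a) : Monotone (stepAt a) :=
  fun _ τ' hle => ha.stepAt_le_iff.2 (hle.trans_lt (ha.lt_elapsed_stepAt_succ τ'))

theorem stepAt_elapsed (ha : IsStepSequence a) (n : ℕ) : stepAt a (elapsed a n) = n :=
  eq_of_forall_ge_iff fun m => by
    rw [ha.stepAt_le_iff, ha.strictMono_elapsed.lt_iff_lt, Nat.lt_succ_iff]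

theorem tendsto_stepAt (ha : IsStepSequence a) : Tendsto (stepAt a) atTop atTop :=
  tendsto_atTop_atTop_of_monotone ha.monotone_stepAt fun n =>
    ⟨elapsed a n, (ha.stepAt_elapsed n).ge⟩

theorem tendsto_elapsed_stepAt_sub (ha : IsStepSequence a) (ha0 : Tendsto a atTop (𝓝 0)) :
    Tendsto (fun τ => elapsed a (stepAt a τ) - τ) atTop (𝓝 0) := by
  refine tendsto_of_tendsto_of_tendsto_of_le_of_le'
    (by simpa only [neg_zero] using (ha0.comp ha.tendsto_stepAt).neg) tendsto_const_nhds ?_ ?_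
  · refine Eventually.of_forall fun τ => ?_
    have hlt := ha.lt_elapsed_stepAt_succ τ
    rw [elapsed_succ] at hlt
    simp only [Function.comp_apply]
    linarith
  · filter_upwards [eventually_ge_atTop 0] with τ hτ
    exact sub_nonpos.2 (ha.elapsed_stepAt_le hτ)

end IsStepSequence

/-! ### Perturbed recursions -/

section PerturbedRecursion

variable {E : Type*} [NormedAddCommGroup E]

/-- The running maximum of `1 + ‖x j‖`. -/
noncomputable def runningNorm (x : ℕ → E) : ℕ →o ℝ :=
  partialSups fun j => 1 + ‖x j‖

theorem one_add_norm_le_runningNorm (x : ℕ → E) {j m : ℕ} (hjm : j ≤ m) :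
    1 + ‖x j‖ ≤ runningNorm x m :=
  le_partialSups_of_le (fun j => 1 + ‖x j‖) hjm

theorem runningNorm_pos (x : ℕ → E) (m : ℕ) : 0 < runningNorm x m :=
  (by positivity : 0 < 1 + ‖x m‖).trans_le (one_add_norm_le_runningNorm x le_rfl)

theorem exists_runningNorm_eq (x : ℕ → E) (m : ℕ) : ∃ j ≤ m, runningNorm x m = 1 + ‖x j‖ :=
  exists_partialSups_eq _ m

variable [NormedSpace ℝ E]

/-- The sequence `x` follows the drift `y` with vanishing step sizes `a`, up to a noise `e` which
already contains the step size. The drift grows at most linearly in the state, and the noise is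
negligible against the running maximum of the state. -/
structure IsPerturbedRecursion (K : ℝ≥0) (a : ℕ → ℝ) (x y e : ℕ → E) : Prop where
  steps : IsStepSequence a
  tendsto_step : Tendsto a atTop (𝓝 0)
  succ : ∀ n, x (n + 1) = x n + a n • y n + e n
  norm_drift_le : ∀ n, ‖y n‖ ≤ K * (1 + ‖x n‖)
  noise : IsTailNegligible e (runningNorm x)

namespace IsPerturbedRecursion

variable {K : ℝ≥0} {a : ℕ → ℝ} {x y e : ℕ → E}

theorem sub_eq_sum (H : IsPerturbedRecursion K a x y e) {n m : ℕ} (hnm : n ≤ m) :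
    x m - x n = ∑ j ∈ Finset.Ico n m, a j • y j + ∑ j ∈ Finset.Ico n m, e j := by
  rw [← Finset.sum_Ico_sub x hnm, ← Finset.sum_add_distrib]
  exact Finset.sum_congr rfl fun j _ => by rw [H.succ, add_assoc, add_sub_cancel_left]

theorem norm_sum_drift_le (H : IsPerturbedRecursion K a x y e) (n m : ℕ) :
    ‖∑ j ∈ Finset.Ico n m, a j • y j‖ ≤ K * ∑ j ∈ Finset.Ico n m, a j * runningNorm x j := by
  rw [Finset.mul_sum]
  refine norm_sum_le_of_le _ fun j _ => ?_
  rw [norm_smul, Real.norm_of_nonneg (H.steps.pos j).le, mul_left_comm]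
  refine mul_le_mul_of_nonneg_left ((H.norm_drift_le j).trans ?_) (H.steps.pos j).le
  gcongr
  exact one_add_norm_le_runningNorm x le_rfl

theorem dist_le (H : IsPerturbedRecursion K a x y e) {n m : ℕ} (hnm : n ≤ m) :
    dist (x m) (x n) ≤ K * (runningNorm x m * (elapsed a m - elapsed a n))
      + ‖∑ j ∈ Finset.Ico n m, e j‖ := by
  have hsum : ∑ j ∈ Finset.Ico n m, a j * runningNorm x j
      ≤ runningNorm x m * (elapsed a m - elapsed a n) := by
    rw [← sum_Ico_eq_elapsed_sub a hnm, mul_comm, Finset.sum_mul]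
    exact Finset.sum_le_sum fun j hj => mul_le_mul_of_nonneg_left
      ((runningNorm x).monotone (Finset.mem_Ico.1 hj).2.le) (H.steps.pos j).le
  rw [dist_eq_norm, H.sub_eq_sum hnm]
  refine (norm_add_le _ _).trans ?_
  gcongr
  exact (H.norm_sum_drift_le n m).trans (by gcongr)

theorem runningNorm_le_add (H : IsPerturbedRecursion K a x y e) {n : ℕ}
    (hn : ∀ i ≥ n, ‖∑ j ∈ Finset.Ico n i, e j‖ ≤ 1 / 2 * runningNorm x i) (m : ℕ) :
    runningNorm x m ≤ 2 * runningNorm x n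
      + 2 * K * ∑ j ∈ Finset.Ico n m, a j * runningNorm x j := by
  have hterm : ∀ j, 0 ≤ a j * runningNorm x j := fun j =>
    mul_nonneg (H.steps.pos j).le (runningNorm_pos x j).le
  have hsum : 0 ≤ K * ∑ j ∈ Finset.Ico n m, a j * runningNorm x j :=
    mul_nonneg K.coe_nonneg (Finset.sum_nonneg fun j _ => hterm j)
  obtain ⟨i, him, hi⟩ := exists_runningNorm_eq x m
  rcases le_total i n with hin | hni
  · have := one_add_norm_le_runningNorm x hin
    linarith [runningNorm_pos x n]
  · have hxi : ‖x i‖ ≤ ‖x n‖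
        + (‖∑ j ∈ Finset.Ico n i, a j • y j‖ + ‖∑ j ∈ Finset.Ico n i, e j‖) := by
      rw [← sub_le_iff_le_add']
      refine (norm_sub_norm_le _ _).trans ?_
      rw [H.sub_eq_sum hni]
      exact norm_add_le _ _
    have hdrift : ‖∑ j ∈ Finset.Ico n i, a j • y j‖
        ≤ K * ∑ j ∈ Finset.Ico n m, a j * runningNorm x j := by
      refine (H.norm_sum_drift_le n i).trans (mul_le_mul_of_nonneg_left ?_ K.coe_nonneg)
      exact Finset.sum_le_sum_of_subset_of_nonneg (Finset.Ico_subset_Ico_right him)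
        fun j _ _ => hterm j
    have := hn i hni
    have := (runningNorm x).monotone him
    have := one_add_norm_le_runningNorm x (le_refl n)
    linarith

theorem eventually_runningNorm_le (H : IsPerturbedRecursion K a x y e) (D : ℝ≥0) :
    ∀ᶠ n in atTop, ∀ m, elapsed a m ≤ elapsed a n + D →
      runningNorm x m ≤ 2 * Real.exp (2 * K * D) * runningNorm x n := by
  filter_upwards [H.noise (1 / 2) (by norm_num)] with n hn m hm
  have hRn := runningNorm_pos x n
  rcases le_total m n with hmn | hnm
  · have hexp : 1 ≤ Real.exp (2 * K * D) := Real.one_le_exp (by positivity)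
    have hRm : runningNorm x m ≤ runningNorm x n := (runningNorm x).monotone hmn
    nlinarith
  let u : ℕ → ℝ := fun i => 2 * runningNorm x n
    + 2 * K * ∑ j ∈ Finset.Ico n i, a j * runningNorm x j
  have hRu : ∀ i, runningNorm x i ≤ u i := H.runningNorm_le_add hn
  have hun : u n = 2 * runningNorm x n := by simp [u]
  have hu : ∀ i ≥ n, u (i + 1) ≤ (1 + 2 * K * a i) * u i + 0 := by
    intro i hi
    have hstep : 2 * K * a i * runningNorm x i ≤ 2 * K * a i * u i :=
      mul_le_mul_of_nonneg_left (hRu i)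
        (mul_nonneg (mul_nonneg zero_le_two K.coe_nonneg) (H.steps.pos i).le)
    have hsucc : u (i + 1) = u i + 2 * K * a i * runningNorm x i := by
      simp only [u, Finset.sum_Ico_succ_top hi]
      ring
    linarith
  calc runningNorm x m ≤ u m := hRu m
    _ ≤ 2 * runningNorm x n * Real.exp (2 * K * (elapsed a m - elapsed a n)) := by
      simpa only [Finset.sum_const_zero, add_zero, hun, ← Finset.mul_sum,
        sum_Ico_eq_elapsed_sub a hnm] using discrete_gronwall (hun ▸ by positivity) hu
          (fun i _ => mul_nonneg (mul_nonneg zero_le_two K.coe_nonneg) (H.steps.pos i).le)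
          (fun _ _ => le_rfl) hnm
    _ ≤ 2 * runningNorm x n * Real.exp (2 * K * D) := by gcongr; linarith
    _ = 2 * Real.exp (2 * K * D) * runningNorm x n := by ring

end IsPerturbedRecursion

end PerturbedRecursion

/-! ### Blow-up limits -/

section BlowUp

variable {E ι : Type*} [NormedAddCommGroup E]

/-- Along the filter `l`, the times `τ` tend to infinity, and so do the scales `c`, which dominate
`1 + ‖x‖` up to any bounded delay after `τ`. -/
structure IsBlowUp (a : ℕ → ℝ) (x : ℕ → E) (l : Filter ι) (τ : ι → ℝ) (c : ι → ℕ) : Prop where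
  tendsto_time : Tendsto τ l atTop
  tendsto_scale : Tendsto c l atTop
  growth : ∀ S : ℝ, ∃ B : ℝ≥0, ∀ᶠ k in l, ∀ j, elapsed a j ≤ τ k + S → runningNorm x j ≤ B * c k

theorem IsBlowUp.mono {a : ℕ → ℝ} {x : ℕ → E} {l l' : Filter ι} {τ : ι → ℝ} {c : ι → ℕ}
    (hB : IsBlowUp a x l τ c) (hl : l' ≤ l) : IsBlowUp a x l' τ c where
  tendsto_time := hB.tendsto_time.mono_left hl
  tendsto_scale := hB.tendsto_scale.mono_left hl
  growth S := (hB.growth S).imp fun _ h => hl h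

/-- The locally Lipschitz curves defined at all times, past and future, that solve `X' ∈ G X`
wherever they are differentiable. -/
structure IsLipschitzTrajectory [NormedSpace ℝ E] (G : E → Set E) (X : ℝ → E) : Prop where
  lipschitz : ∀ S : ℝ, ∃ L : ℝ≥0, LipschitzOnWith L X (Set.Iic S)
  deriv_mem : ∀ t, DifferentiableAt ℝ X t → deriv X t ∈ G (X t)

variable [NormedSpace ℝ E]

/-- The `k`-th blow-up of the sequence `x`: its piecewise constant interpolation on the time scale
of `a`, seen from the time `τ k` and divided by the scale `c k`. -/
noncomputable def rescaled (a : ℕ → ℝ) (x : ℕ → E) (τ : ι → ℝ) (c : ι → ℕ) (k : ι) (s : ℝ) : E :=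
  (c k : ℝ)⁻¹ • x (stepAt a (τ k + s))

namespace IsPerturbedRecursion

variable {K : ℝ≥0} {a : ℕ → ℝ} {x y e : ℕ → E} {l : Filter ι} {τ : ι → ℝ} {c : ι → ℕ}

theorem tendsto_stepAt_add (H : IsPerturbedRecursion K a x y e) (hτ : Tendsto τ l atTop) (s : ℝ) :
    Tendsto (fun k => stepAt a (τ k + s)) l atTop :=
  H.steps.tendsto_stepAt.comp (tendsto_atTop_add_const_right _ s hτ)

theorem tendsto_elapsed_stepAt_add_sub (H : IsPerturbedRecursion K a x y e)
    (hτ : Tendsto τ l atTop) (s : ℝ) :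
    Tendsto (fun k => elapsed a (stepAt a (τ k + s)) - τ k) l (𝓝 s) := by
  have hlim := ((H.steps.tendsto_elapsed_stepAt_sub H.tendsto_step).comp
    (tendsto_atTop_add_const_right _ s hτ)).add_const s
  simpa only [Function.comp_def, ← sub_sub, sub_add_cancel, zero_add] using hlim

theorem eventually_norm_sum_noise_le (H : IsPerturbedRecursion K a x y e)
    (hB : IsBlowUp a x l τ c) (s S : ℝ) {ε : ℝ} (hε : 0 < ε) :
    ∀ᶠ k in l, ∀ j ≥ stepAt a (τ k + s), elapsed a j ≤ τ k + S →
      ‖∑ i ∈ Finset.Ico (stepAt a (τ k + s)) j, e i‖ ≤ ε * c k := by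
  obtain ⟨B, hBk⟩ := hB.growth S
  filter_upwards [hBk, (H.tendsto_stepAt_add hB.tendsto_time s).eventually
    (H.noise (ε / (B + 1)) (by positivity))] with k hgrowth hnoise j hj hjS
  calc _ ≤ ε / (B + 1) * runningNorm x j := hnoise j hj
    _ ≤ ε / (B + 1) * ((B + 1) * c k) := by
        gcongr
        exact (hgrowth j hjS).trans (by gcongr; exact le_add_of_nonneg_right zero_le_one)
    _ = ε * c k := by field_simp

theorem exists_eventually_dist_le (H : IsPerturbedRecursion K a x y e) (hB : IsBlowUp a x l τ c)
    (S : ℝ) : ∃ L : ℝ≥0, ∀ s, ∀ s' ≤ S, ∀ ε > 0, ∀ᶠ k in l, ∀ j ≥ stepAt a (τ k + s),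
      elapsed a j ≤ τ k + s' →
        dist ((c k : ℝ)⁻¹ • x j) (rescaled a x τ c k s) ≤ L * (s' - s) + ε := by
  obtain ⟨B, hBk⟩ := hB.growth S
  refine ⟨K * B, fun s s' hs' ε hε => ?_⟩
  have hδ : 0 < ε / (K * B + 1) := by positivity
  filter_upwards [hBk, H.eventually_norm_sum_noise_le hB s S hδ,
    hB.tendsto_scale.eventually_ge_atTop 1,
    (H.tendsto_elapsed_stepAt_add_sub hB.tendsto_time s).eventually_const_lt
      (sub_lt_self s hδ)] with k hgrowth hnoise hck hstart j hj hjs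
  have hc0 : (0 : ℝ) < c k := mod_cast hck
  have hjS : elapsed a j ≤ τ k + S := hjs.trans (by gcongr)
  have hlen : elapsed a j - elapsed a (stepAt a (τ k + s)) ≤ s' - s + ε / (K * B + 1) := by
    linarith
  have hlen0 : 0 ≤ elapsed a j - elapsed a (stepAt a (τ k + s)) :=
    sub_nonneg.2 (H.steps.strictMono_elapsed.monotone hj)
  rw [rescaled, dist_smul₀, norm_inv, Real.norm_natCast, inv_mul_le_iff₀ hc0, NNReal.coe_mul]
  calc _ ≤ K * (runningNorm x j * (elapsed a j - elapsed a (stepAt a (τ k + s))))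
          + ‖∑ i ∈ Finset.Ico (stepAt a (τ k + s)) j, e i‖ := H.dist_le hj
    _ ≤ K * (B * c k * (s' - s + ε / (K * B + 1))) + ε / (K * B + 1) * c k := by
        gcongr
        exacts [hgrowth j hjS, hnoise j hj hjS]
    _ = c k * (K * B * (s' - s) + ε) := by field_simp; ring

variable {X : ℝ → E}

theorem exists_lipschitzOnWith [l.NeBot] (H : IsPerturbedRecursion K a x y e)
    (hB : IsBlowUp a x l τ c)
    (hX : ∀ s, Tendsto (fun k => rescaled a x τ c k s) l (𝓝 (X s))) (S : ℝ) :
    ∃ L : ℝ≥0, LipschitzOnWith L X (Set.Iic S) := by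
  obtain ⟨L, hL⟩ := H.exists_eventually_dist_le hB S
  have hdist : ∀ s s', s ≤ s' → s' ≤ S → dist (X s') (X s) ≤ L * dist s' s := by
    intro s s' hss' hs'
    rw [Real.dist_eq, abs_of_nonneg (sub_nonneg.2 hss')]
    refine le_of_forall_pos_le_add fun ε hε => le_of_tendsto ((hX s').dist (hX s)) ?_
    filter_upwards [hL s s' hs' ε hε, hB.tendsto_time.eventually_ge_atTop (-s')] with k hk hτk
    exact hk _ (H.steps.monotone_stepAt (by gcongr)) (H.steps.elapsed_stepAt_le (by linarith))
  refine ⟨L, LipschitzOnWith.of_dist_le_mul fun s hs s' hs' => ?_⟩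
  rcases le_total s s' with hle | hle
  · rw [dist_comm, dist_comm s]
    exact hdist s s' hle hs'
  · exact hdist s' s hle hs

/-- The increments of the rescaled state are, up to noise, weighted averages of rescaled drifts. -/
theorem slope_mem [l.NeBot] (H : IsPerturbedRecursion K a x y e) (hB : IsBlowUp a x l τ c)
    (hX : ∀ s, Tendsto (fun k => rescaled a x τ c k s) l (𝓝 (X s))) {D : Set E}
    (hD_convex : Convex ℝ D) (hD_closed : IsClosed D) {s s' : ℝ} (hss' : s < s')
    (hy : ∀ᶠ k in l, ∀ j ∈ Finset.Ico (stepAt a (τ k + s)) (stepAt a (τ k + s')),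
      (c k : ℝ)⁻¹ • y j ∈ D) :
    slope X s s' ∈ D := by
  have hmono : ∀ k, stepAt a (τ k + s) ≤ stepAt a (τ k + s') := fun k =>
    H.steps.monotone_stepAt (by gcongr)
  have hlen : Tendsto (fun k => elapsed a (stepAt a (τ k + s')) - elapsed a (stepAt a (τ k + s)))
      l (𝓝 (s' - s)) := by
    simpa only [sub_sub_sub_cancel_right] using
      (H.tendsto_elapsed_stepAt_add_sub hB.tendsto_time s').sub
        (H.tendsto_elapsed_stepAt_add_sub hB.tendsto_time s)
  have hnoise : Tendsto (fun k => (c k : ℝ)⁻¹ •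
      ∑ j ∈ Finset.Ico (stepAt a (τ k + s)) (stepAt a (τ k + s')), e j) l (𝓝 0) := by
    refine NormedAddGroup.tendsto_nhds_zero.2 fun ε hε => ?_
    filter_upwards [H.eventually_norm_sum_noise_le hB s s' (half_pos hε),
      hB.tendsto_scale.eventually_ge_atTop 1,
      hB.tendsto_time.eventually_ge_atTop (-s')] with k hk hck hτk
    have hc0 : (0 : ℝ) < c k := mod_cast hck
    rw [norm_smul, norm_inv, Real.norm_natCast, inv_mul_lt_iff₀ hc0, mul_comm]
    refine (hk _ (hmono k) (H.steps.elapsed_stepAt_le (by linarith))).trans_lt ?_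
    gcongr
    exact half_lt_self hε
  have hlim := (hlen.inv₀ (sub_pos.2 hss').ne').smul (((hX s').sub (hX s)).sub hnoise)
  rw [sub_zero] at hlim
  refine hD_closed.mem_of_tendsto hlim ?_
  filter_upwards [hy, hlen.eventually_const_lt (sub_pos.2 hss')] with k hk hpos
  have hmem := hD_convex.centerMass_mem (fun j _ => (H.steps.pos j).le)
    (by rwa [sum_Ico_eq_elapsed_sub a (hmono k)]) hk
  rw [Finset.centerMass, sum_Ico_eq_elapsed_sub a (hmono k)] at hmem
  convert hmem using 2
  rw [rescaled, rescaled, ← smul_sub, ← smul_sub, H.sub_eq_sum (hmono k), add_sub_cancel_right,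
    Finset.smul_sum]
  exact Finset.sum_congr rfl fun j _ => smul_comm _ _ _

variable {h G : E → Set E}

theorem eventually_rescaled_drift_mem [ProperSpace E] (H : IsPerturbedRecursion K a x y e)
    (hy : ∀ n, y n ∈ h (x n)) (hK : ∀ u, ∀ w ∈ h u, ‖w‖ ≤ K * (1 + ‖u‖))
    (hG : IsScalingLimit h G) (hB : IsBlowUp a x l τ c)
    (hX : ∀ s, Tendsto (fun k => rescaled a x τ c k s) l (𝓝 (X s))) (s : ℝ) {η : ℝ}
    (hη : 0 < η) :
    ∀ᶠ s' in 𝓝[>] s, ∀ᶠ k in l, ∀ j ∈ Finset.Ico (stepAt a (τ k + s)) (stepAt a (τ k + s')),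
      (c k : ℝ)⁻¹ • y j ∈ Metric.cthickening η (G (X s)) := by
  obtain ⟨⟨N, ε⟩, ⟨-, hε⟩, hN⟩ := (atTop_basis.prod Metric.nhds_basis_ball).eventually_iff.1
    (hG.eventually_mem_cthickening hK (X s) hη)
  simp only at hε hN
  obtain ⟨L, hL⟩ := H.exists_eventually_dist_le hB (s + 1)
  have hclose : ∀ᶠ s' in 𝓝 s, L * (s' - s) < ε / 3 :=
    ContinuousAt.eventually_lt (by fun_prop) continuousAt_const
      (by simpa only [sub_self, mul_zero] using by positivity)
  filter_upwards [nhdsWithin_le_nhds hclose,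
    nhdsWithin_le_nhds (eventually_le_nhds (lt_add_one s))] with s' hs' hs'1
  filter_upwards [hL s s' hs'1 (ε / 3) (by positivity), hB.tendsto_scale.eventually_ge_atTop N,
    hB.tendsto_scale.eventually_ge_atTop 1,
    (hX s).eventually (Metric.ball_mem_nhds (X s) (by positivity : 0 < ε / 3))]
    with k hdist hcN hc1 hXk j hj
  obtain ⟨hsj, hjs'⟩ := Finset.mem_Ico.1 hj
  have hc0 : (c k : ℝ) ≠ 0 := by positivity
  have hxj : dist ((c k : ℝ)⁻¹ • x j) (X s) < ε := by
    have hj_time : elapsed a j ≤ τ k + s' :=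
      (H.steps.strictMono_elapsed.monotone j.le_succ).trans (H.steps.elapsed_le_of_lt_stepAt hjs')
    linarith [hdist j hsj hj_time, Metric.mem_ball.1 hXk,
      dist_triangle ((c k : ℝ)⁻¹ • x j) (rescaled a x τ c k s) (X s)]
  refine hN (x := (c k, (c k : ℝ)⁻¹ • x j)) ⟨hcN, hxj⟩ _ ?_
  simpa only [smul_inv_smul₀ hc0] using hy j

theorem isLipschitzTrajectory [ProperSpace E] [l.NeBot] (H : IsPerturbedRecursion K a x y e)
    (hy : ∀ n, y n ∈ h (x n)) (hK : ∀ u, ∀ w ∈ h u, ‖w‖ ≤ K * (1 + ‖u‖))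
    (hG_convex : ∀ u, Convex ℝ (G u)) (hG_closed : ∀ u, IsClosed (G u))
    (hG : IsScalingLimit h G) (hB : IsBlowUp a x l τ c)
    (hX : ∀ s, Tendsto (fun k => rescaled a x τ c k s) l (𝓝 (X s))) :
    IsLipschitzTrajectory G X := by
  refine ⟨H.exists_lipschitzOnWith hB hX, fun s hs => ?_⟩
  have hslope : Tendsto (slope X s) (𝓝[>] s) (𝓝 (deriv X s)) :=
    (hasDerivAt_iff_tendsto_slope.1 hs.hasDerivAt).mono_left
      (nhdsWithin_mono _ fun _ ht => ne_of_gt ht)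
  rw [← (hG_closed (X s)).closure_eq, Metric.closure_eq_iInter_cthickening]
  refine Set.mem_iInter₂.2 fun η hη => Metric.isClosed_cthickening.mem_of_tendsto hslope ?_
  filter_upwards [H.eventually_rescaled_drift_mem hy hK hG hB hX s hη, self_mem_nhdsWithin]
    with s' hdrift hss'
  exact H.slope_mem hB hX ((hG_convex _).cthickening η) Metric.isClosed_cthickening hss' hdrift

end IsPerturbedRecursion

theorem IsBlowUp.exists_tendsto_rescaled [ProperSpace E] {a : ℕ → ℝ} {x : ℕ → E}
    {l : Ultrafilter ι} {τ : ι → ℝ} {c : ι → ℕ} (ha : IsStepSequence a)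
    (hB : IsBlowUp a x l τ c) (s : ℝ) :
    ∃ p, Tendsto (fun k => rescaled a x τ c k s) l (𝓝 p) := by
  obtain ⟨B, hBk⟩ := hB.growth s
  have hmem : ∀ᶠ k in l, rescaled a x τ c k s ∈ Metric.closedBall (0 : E) B := by
    filter_upwards [hBk, hB.tendsto_scale.eventually_ge_atTop 1,
      hB.tendsto_time.eventually_ge_atTop (-s)] with k hk hck hτk
    have hc0 : (0 : ℝ) < c k := mod_cast hck
    rw [mem_closedBall_zero_iff, rescaled, norm_smul, norm_inv, Real.norm_natCast,
      inv_mul_le_iff₀ hc0, mul_comm]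
    have hnorm := one_add_norm_le_runningNorm x (le_refl (stepAt a (τ k + s)))
    linarith [hk _ (ha.elapsed_stepAt_le (by linarith))]
  obtain ⟨p, -, hp⟩ := (isCompact_closedBall (0 : E) B).ultrafilter_le_nhds
    (l.map fun k => rescaled a x τ c k s) (le_principal_iff.2 hmem)
  exact ⟨p, hp⟩

end BlowUp

/-! ### Boundedness of perturbed recursions -/

section Boundedness

theorem exists_records_of_not_bddAbove {α : Type*} [LinearOrder α] [NoMaxOrder α] {u : ℕ → α}
    (hu : ¬ BddAbove (Set.range u)) :
    ∃ n : ℕ → ℕ, Tendsto n atTop atTop ∧ Tendsto (u ∘ n) atTop atTop ∧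
      ∀ k, ∀ j ≤ n k, u j ≤ u (n k) := by
  have hsups : Tendsto (partialSups u) atTop atTop := by
    refine tendsto_atTop_atTop_of_monotone (partialSups u).monotone fun b => ?_
    obtain ⟨_, ⟨n, rfl⟩, hn⟩ := not_bddAbove_iff.1 hu b
    exact ⟨n, hn.le.trans (le_partialSups u n)⟩
  obtain ⟨n, hn, hrecord⟩ := exists_seq_forall_of_frequently (frequently_high_scores hsups)
  have heq : ∀ k, partialSups u (n k) = u (n k) := by
    intro k
    obtain ⟨j, hj, hju⟩ := exists_partialSups_eq u (n k)
    rcases hj.lt_or_eq with hlt | rfl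
    · exact absurd (hju ▸ hrecord k j hlt) (le_partialSups u j).not_gt
    · exact hju
  exact ⟨n, hn, (hsups.comp hn).congr heq, fun k j hj => heq k ▸ le_partialSups_of_le u hj⟩

variable {E ι : Type*} [NormedAddCommGroup E] [NormedSpace ℝ E] {K : ℝ≥0} {a : ℕ → ℝ}
  {x y e : ℕ → E}

namespace IsPerturbedRecursion

theorem isBlowUp (H : IsPerturbedRecursion K a x y e) {l : Filter ι} {n c : ι → ℕ}
    (hn : Tendsto n l atTop) (hc : Tendsto c l atTop) {C : ℝ≥0}
    (hC : ∀ᶠ k in l, runningNorm x (n k) ≤ C * c k) (T : ℝ) :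
    IsBlowUp a x l (fun k => elapsed a (n k) - T) c where
  tendsto_time := tendsto_atTop_add_const_right _ (-T) (H.steps.tendsto_elapsed.comp hn)
  tendsto_scale := hc
  growth S := by
    refine ⟨(2 * Real.exp (2 * K * (S - T).toNNReal)).toNNReal * C, ?_⟩
    filter_upwards [hn.eventually (H.eventually_runningNorm_le (S - T).toNNReal), hC]
      with k hgrowth hCk j hj
    rw [NNReal.coe_mul, Real.coe_toNNReal _ (by positivity), mul_assoc]
    refine (hgrowth j (by linarith [Real.le_coe_toNNReal (S - T)])).trans ?_
    gcongr

theorem bddAbove_norm [ProperSpace E] (H : IsPerturbedRecursion K a x y e) {h G : E → Set E}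
    (hy : ∀ n, y n ∈ h (x n)) (hK : ∀ u, ∀ w ∈ h u, ‖w‖ ≤ K * (1 + ‖u‖))
    (hG_convex : ∀ u, Convex ℝ (G u)) (hG_closed : ∀ u, IsClosed (G u))
    (hG : IsScalingLimit h G) {T : ℝ} (hT : 0 ≤ T)
    (hGT : ∀ X, IsLipschitzTrajectory G X → ‖X 0‖ ≤ 1 → ‖X T‖ < 1) :
    BddAbove (Set.range fun n => ‖x n‖) := by
  by_contra hunbounded
  obtain ⟨n, hn, hxn, hrecord⟩ := exists_records_of_not_bddAbove hunbounded
  set c : ℕ → ℕ := fun k => ⌈‖x (n k)‖⌉₊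
  have hc : Tendsto c atTop atTop := tendsto_nat_ceil_atTop.comp hxn
  have hnorm_le : ∀ k, ∀ j ≤ n k, ‖x j‖ ≤ c k := fun k j hj =>
    (hrecord k j hj).trans (Nat.le_ceil _)
  have hrun : ∀ᶠ k in atTop, runningNorm x (n k) ≤ (2 : ℝ≥0) * c k := by
    filter_upwards [hc.eventually_ge_atTop 1] with k hck
    obtain ⟨j, hj, hjx⟩ := exists_runningNorm_eq x (n k)
    have hck' : (1 : ℝ) ≤ c k := mod_cast hck
    rw [hjx, NNReal.coe_ofNat, two_mul]
    exact add_le_add hck' (hnorm_le k j hj)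
  have hB := (H.isBlowUp hn hc hrun T).mono Nat.hyperfilter_le_atTop
  choose X hX using hB.exists_tendsto_rescaled H.steps
  refine (hGT X (H.isLipschitzTrajectory hy hK hG_convex hG_closed hG hB hX) ?_).ne ?_
  · refine le_of_tendsto (hX 0).norm (Eventually.of_forall fun k => ?_)
    have hstep : stepAt a (elapsed a (n k) - T + 0) ≤ n k := by
      conv_rhs => rw [← H.steps.stepAt_elapsed (n k)]
      exact H.steps.monotone_stepAt (by linarith)
    rw [rescaled, norm_smul, norm_inv, Real.norm_natCast]
    exact inv_mul_le_one_of_le₀ (hnorm_le k _ hstep) (c k).cast_nonneg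
  · have hratio : Tendsto (fun k => ‖rescaled a x (fun k => elapsed a (n k) - T) c k T‖) atTop
        (𝓝 1) := by
      have hlim := ((tendsto_nat_ceil_div_atTop (R := ℝ)).comp hxn).inv₀ one_ne_zero
      simpa only [rescaled, sub_add_cancel, H.steps.stepAt_elapsed, norm_smul, norm_inv,
        Real.norm_natCast, Function.comp_def, inv_div, ← div_eq_inv_mul, inv_one] using hlim
    exact tendsto_nhds_unique (hX T).norm (hratio.mono_left Nat.hyperfilter_le_atTop)

end IsPerturbedRecursion

end Boundedness

section LipschitzTrajectory

variable {E : Type*} [NormedAddCommGroup E] [NormedSpace ℝ E]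

theorem IsLipschitzTrajectory.ae_differentiableAt [FiniteDimensional ℝ E] {G : E → Set E}
    {X : ℝ → E} (hX : IsLipschitzTrajectory G X) : ∀ᵐ t : ℝ, DifferentiableAt ℝ X t := by
  have hae : ∀ S : ℕ, ∀ᵐ t : ℝ, t ∈ Set.Iic (S : ℝ) →
      DifferentiableWithinAt ℝ X (Set.Iic (S : ℝ)) t := fun S =>
    (hX.lipschitz S).choose_spec.ae_differentiableWithinAt_of_mem
  filter_upwards [ae_all_iff.2 hae] with t ht
  obtain ⟨S, hS⟩ := exists_nat_gt t
  exact (ht S hS.le).differentiableAt (Iic_mem_nhds hS)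

variable {d : ℕ} {G : EuclideanSpace ℝ (Fin d) → Set (EuclideanSpace ℝ (Fin d))}

theorem IsLipschitzTrajectory.isDISolution {X : ℝ → EuclideanSpace ℝ (Fin d)}
    (hX : IsLipschitzTrajectory G X) : IsDISolution G X where
  absolutelyContinuous b hb := by
    obtain ⟨L, hL⟩ := hX.lipschitz b
    refine (hL.mono ?_).absolutelyContinuousOnInterval
    rw [Set.uIcc_of_le hb]
    exact Set.Icc_subset_Iic_self
  deriv_mem := ae_restrict_of_ae <|
    hX.ae_differentiableAt.mono fun t ht => ⟨ht, hX.deriv_mem t ht⟩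

theorem IsAttractingSet.exists_norm_lt_one {A U : Set (EuclideanSpace ℝ (Fin d))}
    (hAU : IsAttractingSet G A U) (hU : Metric.closedBall 0 1 ⊆ U) (hA : A ⊆ Metric.ball 0 1) :
    ∃ T : ℝ, 0 ≤ T ∧ ∀ X, IsDISolution G X → ‖X 0‖ ≤ 1 → ‖X T‖ < 1 := by
  obtain ⟨δ, hδ, hδA⟩ := hAU.isCompact.exists_thickening_subset_open Metric.isOpen_ball hA
  obtain ⟨T, hT, hTA⟩ := hAU.attracts δ hδ
  refine ⟨T, hT, fun X hX hX0 => mem_ball_zero_iff.1 (hδA (hTA ?_))⟩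
  exact Set.mem_iUnion₂.2 ⟨T, Set.self_mem_Ici, Set.mem_iUnion₂.2
    ⟨X 0, hU (mem_closedBall_zero_iff.2 hX0), X, hX, rfl, rfl⟩⟩

end LipschitzTrajectory

/-! ### Martingale noise -/

section MartingaleNoise

variable {Ω : Type*} {m0 : MeasurableSpace Ω} {μ : Measure Ω} {ℱ : Filtration ℕ m0}

/-- Square integrable martingale increments `ξ` for the filtration `ℱ`. The increment `ξ n` is
revealed at time `n + 1`. -/
structure IsMartingaleIncrement {E : Type*} [NormedAddCommGroup E] [NormedSpace ℝ E]
    [CompleteSpace E] (ξ : ℕ → Ω → E) (ℱ : Filtration ℕ m0) (μ : Measure Ω) : Prop where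
  stronglyMeasurable : ∀ n, StronglyMeasurable[ℱ (n + 1)] (ξ n)
  memLp : ∀ n, MemLp (ξ n) 2 μ
  condExp_eq_zero : ∀ n, μ[ξ n | ℱ n] =ᵐ[μ] 0

namespace IsMartingaleIncrement

section Real

variable {ξ : ℕ → Ω → ℝ}

theorem stronglyMeasurable_sum (hξ : IsMartingaleIncrement ξ ℱ μ) (n : ℕ) :
    StronglyMeasurable[ℱ n] (∑ j ∈ Finset.range n, ξ j) :=
  Finset.stronglyMeasurable_sum _ fun j hj =>
    (hξ.stronglyMeasurable j).mono (ℱ.mono (Nat.succ_le_of_lt (Finset.mem_range.1 hj)))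

theorem memLp_sum (hξ : IsMartingaleIncrement ξ ℱ μ) (n : ℕ) :
    MemLp (∑ j ∈ Finset.range n, ξ j) 2 μ :=
  memLp_finsetSum' _ fun j _ => hξ.memLp j

theorem martingale_sum [IsFiniteMeasure μ] (hξ : IsMartingaleIncrement ξ ℱ μ) :
    Martingale (fun n => ∑ j ∈ Finset.range n, ξ j) ℱ μ :=
  martingale_of_condExp_sub_eq_zero_nat hξ.stronglyMeasurable_sum
    (fun n => (hξ.memLp_sum n).integrable one_le_two) fun n => by
      simpa only [Finset.sum_range_succ_sub_sum] using hξ.condExp_eq_zero n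

theorem integral_mul_eq_zero [IsFiniteMeasure μ] (hξ : IsMartingaleIncrement ξ ℱ μ) {n : ℕ}
    {f : Ω → ℝ} (hf : StronglyMeasurable[ℱ n] f) (hf2 : MemLp f 2 μ) :
    ∫ ω, f ω * ξ n ω ∂μ = 0 := by
  have hcond : μ[f * ξ n | ℱ n] =ᵐ[μ] 0 := by
    filter_upwards [condExp_mul_of_stronglyMeasurable_left hf (hf2.integrable_mul (hξ.memLp n))
      ((hξ.memLp n).integrable one_le_two), hξ.condExp_eq_zero n] with ω hω hω'
    rw [hω, Pi.mul_apply, hω', Pi.zero_apply, mul_zero]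
  exact (integral_condExp (ℱ.le n)).symm.trans
    ((integral_congr_ae hcond).trans (integral_zero Ω ℝ))

theorem integral_sum_sq [IsFiniteMeasure μ] (hξ : IsMartingaleIncrement ξ ℱ μ) (n : ℕ) :
    ∫ ω, ((∑ j ∈ Finset.range n, ξ j) ω) ^ 2 ∂μ
      = ∑ j ∈ Finset.range n, ∫ ω, ξ j ω ^ 2 ∂μ := by
  induction n with
  | zero => simp
  | succ n ih =>
    set Z : Ω → ℝ := ∑ j ∈ Finset.range n, ξ j
    have hZ2 : MemLp Z 2 μ := hξ.memLp_sum n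
    have hcross : Integrable (fun ω => 2 * (Z ω * ξ n ω)) μ :=
      (hZ2.integrable_mul (hξ.memLp n)).const_mul 2
    calc ∫ ω, ((∑ j ∈ Finset.range (n + 1), ξ j) ω) ^ 2 ∂μ
        = ∫ ω, (Z ω ^ 2 + 2 * (Z ω * ξ n ω) + ξ n ω ^ 2) ∂μ := by
          refine integral_congr_ae (Eventually.of_forall fun ω => ?_)
          simp only [Finset.sum_range_succ, Pi.add_apply, Z]
          ring
      _ = ∫ ω, Z ω ^ 2 ∂μ + 2 * ∫ ω, Z ω * ξ n ω ∂μ + ∫ ω, ξ n ω ^ 2 ∂μ := by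
          have hZ_cross : Integrable (fun ω => Z ω ^ 2 + 2 * (Z ω * ξ n ω)) μ :=
            hZ2.integrable_sq.add hcross
          rw [integral_add hZ_cross (hξ.memLp n).integrable_sq,
            integral_add hZ2.integrable_sq hcross, integral_const_mul]
      _ = ∑ j ∈ Finset.range (n + 1), ∫ ω, ξ j ω ^ 2 ∂μ := by
          rw [hξ.integral_mul_eq_zero (hξ.stronglyMeasurable_sum n) hZ2, ih, mul_zero, add_zero,
            Finset.sum_range_succ]

theorem ae_exists_tendsto_sum_real [IsFiniteMeasure μ] (hξ : IsMartingaleIncrement ξ ℱ μ)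
    (hsum : Summable fun n => ∫ ω, ξ n ω ^ 2 ∂μ) :
    ∀ᵐ ω ∂μ, ∃ l, Tendsto (fun n => ∑ j ∈ Finset.range n, ξ j ω) atTop (𝓝 l) := by
  simp only [← Finset.sum_apply]
  refine hξ.martingale_sum.submartingale.exists_ae_tendsto_of_bdd
    (R := (μ.real Set.univ + ∑' j, ∫ ω, ξ j ω ^ 2 ∂μ).toNNReal) fun n => ?_
  have hZ_int := (hξ.memLp_sum n).integrable one_le_two
  rw [eLpNorm_one_eq_lintegral_enorm, ← ofReal_integral_norm_eq_lintegral_enorm hZ_int]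
  refine ENNReal.ofReal_le_ofReal ?_
  set Z : Ω → ℝ := ∑ j ∈ Finset.range n, ξ j
  calc ∫ ω, ‖Z ω‖ ∂μ ≤ ∫ ω, (1 + Z ω ^ 2) ∂μ := by
        refine integral_mono hZ_int.norm
          ((integrable_const 1).add (hξ.memLp_sum n).integrable_sq) fun ω => ?_
        dsimp only
        rw [← sq_abs, Real.norm_eq_abs]
        nlinarith [sq_nonneg (|Z ω| - 1), abs_nonneg (Z ω)]
    _ = μ.real Set.univ + ∫ ω, Z ω ^ 2 ∂μ := by
        rw [integral_add (integrable_const 1) (hξ.memLp_sum n).integrable_sq, integral_const,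
          smul_eq_mul, mul_one]
    _ ≤ μ.real Set.univ + ∑' j, ∫ ω, ξ j ω ^ 2 ∂μ := by
        rw [hξ.integral_sum_sq]
        gcongr
        exact hsum.sum_le_tsum _ fun j _ => integral_nonneg fun ω => sq_nonneg _

end Real

variable {E : Type*} [NormedAddCommGroup E] [NormedSpace ℝ E] {ξ : ℕ → Ω → E}

theorem clm_comp [CompleteSpace E] [IsFiniteMeasure μ] {F : Type*} [NormedAddCommGroup F]
    [NormedSpace ℝ F] [CompleteSpace F] (hξ : IsMartingaleIncrement ξ ℱ μ) (f : E →L[ℝ] F) :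
    IsMartingaleIncrement (fun n => f ∘ ξ n) ℱ μ where
  stronglyMeasurable n := f.continuous.comp_stronglyMeasurable (hξ.stronglyMeasurable n)
  memLp n := f.comp_memLp' (hξ.memLp n)
  condExp_eq_zero n := by
    filter_upwards [f.comp_condExp_comm (m := ℱ n) ((hξ.memLp n).integrable one_le_two),
      hξ.condExp_eq_zero n] with ω hω hω'
    rw [← hω, Function.comp_apply, hω', Pi.zero_apply, map_zero, Pi.zero_apply]

theorem smul [CompleteSpace E] [IsFiniteMeasure μ] (hξ : IsMartingaleIncrement ξ ℱ μ)
    {w : ℕ → Ω → ℝ} (hw : ∀ n, StronglyMeasurable[ℱ n] (w n)) {C : ℕ → ℝ}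
    (hC : ∀ n ω, ‖w n ω‖ ≤ C n) : IsMartingaleIncrement (fun n => w n • ξ n) ℱ μ := by
  have hmemLp : ∀ n, MemLp (w n • ξ n) 2 μ := fun n =>
    (hξ.memLp n).smul (memLp_top_of_bound ((hw n).mono (ℱ.le n)).aestronglyMeasurable (C n)
      (Eventually.of_forall (hC n)))
  refine ⟨fun n => ((hw n).mono (ℱ.mono n.le_succ)).smul (hξ.stronglyMeasurable n), hmemLp,
    fun n => ?_⟩
  filter_upwards [condExp_smul_of_aestronglyMeasurable_left (hw n).aestronglyMeasurable
    ((hmemLp n).integrable one_le_two) ((hξ.memLp n).integrable one_le_two),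
    hξ.condExp_eq_zero n] with ω hω hω'
  rw [hω, Pi.smul_apply', hω', Pi.zero_apply, smul_zero]

theorem ae_exists_tendsto_sum [ProperSpace E] [IsFiniteMeasure μ]
    (hξ : IsMartingaleIncrement ξ ℱ μ) (hsum : Summable fun n => ∫ ω, ‖ξ n ω‖ ^ 2 ∂μ) :
    ∀ᵐ ω ∂μ, ∃ l, Tendsto (fun n => ∑ j ∈ Finset.range n, ξ j ω) atTop (𝓝 l) := by
  have : FiniteDimensional ℝ E := .of_locallyCompactSpace ℝ
  let b := Module.finBasis ℝ E
  let f : Fin (Module.finrank ℝ E) → E →L[ℝ] ℝ := fun i => (b.coord i).toContinuousLinearMap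
  have hcoord : ∀ i, ∀ᵐ ω ∂μ, ∃ l,
      Tendsto (fun n => ∑ j ∈ Finset.range n, f i (ξ j ω)) atTop (𝓝 l) := fun i => by
    refine (hξ.clm_comp (f i)).ae_exists_tendsto_sum_real ?_
    refine (hsum.mul_left (‖f i‖ ^ 2)).of_nonneg_of_le
      (fun n => integral_nonneg fun ω => sq_nonneg _) fun n => ?_
    rw [← integral_const_mul]
    refine integral_mono ((hξ.clm_comp (f i)).memLp n).integrable_sq
      (((hξ.memLp n).integrable_norm_pow two_ne_zero).const_mul _) fun ω => ?_
    dsimp only [Function.comp_apply]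
    rw [← mul_pow, sq_le_sq, abs_of_nonneg (by positivity : 0 ≤ ‖f i‖ * ‖ξ n ω‖)]
    exact (f i).le_opNorm _
  filter_upwards [ae_all_iff.2 hcoord] with ω hω
  choose l hl using hω
  refine ⟨∑ i, l i • b i, (tendsto_finsetSum _ fun i _ => (hl i).smul_const (b i)).congr
    fun n => ?_⟩
  simp only [← map_sum]
  exact b.sum_repr _

end IsMartingaleIncrement

theorem integral_norm_smul_sq {E : Type*} [NormedAddCommGroup E] [NormedSpace ℝ E]
    {m : MeasurableSpace Ω} (hm : m ≤ m0) [SigmaFinite (μ.trim hm)] {ξ : Ω → E}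
    (hξ : MemLp ξ 2 μ) {w : Ω → ℝ} (hw : StronglyMeasurable[m] w) {C : ℝ}
    (hC : ∀ ω, ‖w ω‖ ≤ C) :
    ∫ ω, ‖w ω • ξ ω‖ ^ 2 ∂μ = ∫ ω, w ω ^ 2 * (μ[fun ω => ‖ξ ω‖ ^ 2 | m]) ω ∂μ := by
  have hξ_sq : Integrable (fun ω => ‖ξ ω‖ ^ 2) μ := hξ.integrable_norm_pow two_ne_zero
  have hprod : Integrable ((fun ω => w ω ^ 2) * fun ω => ‖ξ ω‖ ^ 2) μ :=
    hξ_sq.bdd_mul ((hw.pow 2).mono hm).aestronglyMeasurable (c := C ^ 2)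
      (Eventually.of_forall fun ω => by
        rw [norm_pow]; exact pow_le_pow_left₀ (norm_nonneg _) (hC ω) 2)
  calc ∫ ω, ‖w ω • ξ ω‖ ^ 2 ∂μ = ∫ ω, ((fun ω => w ω ^ 2) * fun ω => ‖ξ ω‖ ^ 2) ω ∂μ := by
        simp only [norm_smul, mul_pow, Real.norm_eq_abs, sq_abs, Pi.mul_apply]
    _ = ∫ ω, (μ[(fun ω => w ω ^ 2) * fun ω => ‖ξ ω‖ ^ 2 | m]) ω ∂μ := (integral_condExp hm).symm
    _ = ∫ ω, w ω ^ 2 * (μ[fun ω => ‖ξ ω‖ ^ 2 | m]) ω ∂μ :=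
        integral_congr_ae (condExp_mul_of_stronglyMeasurable_left (hw.pow 2) hprod hξ_sq)

variable {E : Type*} [NormedAddCommGroup E]

theorem IsMartingaleIncrement.ae_isTailNegligible [NormedSpace ℝ E] [ProperSpace E]
    [IsFiniteMeasure μ] {z : ℕ → Ω → E} (hz : IsMartingaleIncrement z ℱ μ)
    {a : ℕ → ℝ} (ha : Summable fun n => a n ^ 2) {g : ℕ → Ω → ℝ}
    (hg : ∀ n, StronglyMeasurable[ℱ n] (g n)) (hg_mono : ∀ ω, Monotone fun n => g n ω)
    (hg_one : ∀ n ω, 1 ≤ g n ω)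
    (hgz : ∀ n, μ[fun ω => ‖z n ω‖ ^ 2 | ℱ n] ≤ᵐ[μ] fun ω => g n ω ^ 2) :
    ∀ᵐ ω ∂μ, IsTailNegligible (fun n => a n • z n ω) fun n => g n ω := by
  have hg_pos : ∀ n ω, 0 < g n ω := fun n ω => zero_lt_one.trans_le (hg_one n ω)
  let w : ℕ → Ω → ℝ := fun n ω => (g n ω)⁻¹ * a n
  have hw : ∀ n, StronglyMeasurable[ℱ n] (w n) := fun n =>
    (hg n).inv₀.mul_const (a n)
  have hw_le : ∀ n ω, ‖w n ω‖ ≤ |a n| := fun n ω => by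
    rw [norm_mul, norm_inv, Real.norm_of_nonneg (hg_pos n ω).le, Real.norm_eq_abs]
    exact mul_le_of_le_one_left (abs_nonneg _) (inv_le_one_of_one_le₀ (hg_one n ω))
  have hvar : ∀ n, ∫ ω, ‖(w n • z n) ω‖ ^ 2 ∂μ ≤ a n ^ 2 * μ.real Set.univ := by
    intro n
    refine (integral_norm_smul_sq (ℱ.le n) (hz.memLp n) (hw n) (hw_le n)).trans_le ?_
    refine (integral_mono_of_nonneg ?_ (integrable_const (a n ^ 2)) ?_).trans_eq ?_
    · filter_upwards [condExp_nonneg (m := ℱ n)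
        (Eventually.of_forall fun ω => sq_nonneg ‖z n ω‖)] with ω hω
      exact mul_nonneg (sq_nonneg _) hω
    · filter_upwards [hgz n] with ω hω
      calc _ ≤ w n ω ^ 2 * g n ω ^ 2 := mul_le_mul_of_nonneg_left hω (sq_nonneg _)
        _ = a n ^ 2 := by
          have := (hg_pos n ω).ne'
          simp only [w]
          field_simp
    · rw [integral_const, smul_eq_mul, mul_comm]
  have hsum : Summable fun n => ∫ ω, ‖(w n • z n) ω‖ ^ 2 ∂μ :=
    (ha.mul_right _).of_nonneg_of_le (fun n => integral_nonneg fun ω => sq_nonneg _) hvar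
  filter_upwards [(hz.smul hw hw_le).ae_exists_tendsto_sum hsum] with ω ⟨l, hl⟩
  refine isTailNegligible_of_tendsto_sum (hg_mono ω) (fun n => hg_pos n ω) (l := l) ?_
  simpa only [smul_smul, w, Pi.smul_apply'] using hl

/-- The running maximum of one plus the conditional standard deviations of the increments `z`. It
serves as a weight adapted to `ℱ`; the state of a recursion driven by `z` need not be adapted. -/
noncomputable def runningDeviation (μ : Measure Ω) (ℱ : Filtration ℕ m0) (z : ℕ → Ω → E)
    (n : ℕ) (ω : Ω) : ℝ :=
  partialSups (fun j => 1 + √((μ[fun ω => ‖z j ω‖ ^ 2 | ℱ j]) ω)) n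

theorem one_add_sqrt_condExp_le_runningDeviation (z : ℕ → Ω → E) (n : ℕ) (ω : Ω) :
    1 + √((μ[fun ω => ‖z n ω‖ ^ 2 | ℱ n]) ω) ≤ runningDeviation μ ℱ z n ω :=
  le_partialSups (fun j => 1 + √((μ[fun ω => ‖z j ω‖ ^ 2 | ℱ j]) ω)) n

theorem one_le_runningDeviation (z : ℕ → Ω → E) (n : ℕ) (ω : Ω) :
    1 ≤ runningDeviation μ ℱ z n ω :=
  (le_add_of_nonneg_right (Real.sqrt_nonneg _)).trans
    (one_add_sqrt_condExp_le_runningDeviation z n ω)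

theorem condExp_le_runningDeviation_sq (z : ℕ → Ω → E) (n : ℕ) (ω : Ω) :
    (μ[fun ω => ‖z n ω‖ ^ 2 | ℱ n]) ω ≤ runningDeviation μ ℱ z n ω ^ 2 :=
  (Real.sqrt_le_left (zero_le_one.trans (one_le_runningDeviation z n ω))).1 <|
    (le_add_of_nonneg_left zero_le_one).trans (one_add_sqrt_condExp_le_runningDeviation z n ω)

theorem monotone_runningDeviation (z : ℕ → Ω → E) (ω : Ω) :
    Monotone fun n => runningDeviation μ ℱ z n ω :=
  (partialSups fun j => 1 + √((μ[fun ω => ‖z j ω‖ ^ 2 | ℱ j]) ω)).monotone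

theorem measurable_partialSups_apply {m : MeasurableSpace Ω} {α : Type*} [MeasurableSpace α]
    [SemilatticeSup α] [MeasurableSup₂ α] {f : ℕ → Ω → α} {n : ℕ}
    (hf : ∀ j ≤ n, Measurable (f j)) : Measurable fun ω => partialSups (fun j => f j ω) n := by
  simp only [partialSups_apply, ← Finset.sup'_apply]
  exact Finset.measurable_sup' _ fun j hj => hf j (Finset.mem_Iic.1 hj)

theorem stronglyMeasurable_runningDeviation (z : ℕ → Ω → E) (n : ℕ) :
    StronglyMeasurable[ℱ n] (runningDeviation μ ℱ z n) := by
  refine (measurable_partialSups_apply fun j hj => ?_).stronglyMeasurable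
  exact (stronglyMeasurable_condExp.mono (ℱ.mono hj)).measurable.sqrt.const_add 1

theorem runningDeviation_le {z x : ℕ → Ω → E} {K : ℝ} {ω : Ω}
    (hK : ∀ n, (μ[fun ω => ‖z n ω‖ ^ 2 | ℱ n]) ω ≤ K * (1 + ‖x n ω‖ ^ 2)) (n : ℕ) :
    runningDeviation μ ℱ z n ω ≤ (1 + √K) * runningNorm (fun j => x j ω) n := by
  refine partialSups_le _ _ _ fun j hj => ?_
  have hsqrt : √((μ[fun ω => ‖z j ω‖ ^ 2 | ℱ j]) ω) ≤ √K * (1 + ‖x j ω‖) := by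
    calc _ ≤ √(K * (1 + ‖x j ω‖ ^ 2)) := Real.sqrt_le_sqrt (hK j)
      _ = √K * √(1 + ‖x j ω‖ ^ 2) := Real.sqrt_mul' _ (by positivity)
      _ ≤ √K * (1 + ‖x j ω‖) := by
        gcongr
        exact Real.sqrt_le_left (by positivity) |>.2 (by nlinarith [norm_nonneg (x j ω)])
  calc 1 + √((μ[fun ω => ‖z j ω‖ ^ 2 | ℱ j]) ω) ≤ (1 + √K) * (1 + ‖x j ω‖) := by
        nlinarith [norm_nonneg (x j ω)]
    _ ≤ (1 + √K) * runningNorm (fun j => x j ω) n := by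
        gcongr
        exact one_add_norm_le_runningNorm (fun j => x j ω) hj

theorem IsMartingaleIncrement.ae_isTailNegligible_runningNorm [NormedSpace ℝ E]
    [ProperSpace E] [IsFiniteMeasure μ] {z x : ℕ → Ω → E}
    (hz : IsMartingaleIncrement z ℱ μ) {K : ℝ}
    (hK : ∀ n, μ[fun ω => ‖z n ω‖ ^ 2 | ℱ n] ≤ᵐ[μ] fun ω => K * (1 + ‖x n ω‖ ^ 2))
    {a : ℕ → ℝ} (ha : Summable fun n => a n ^ 2) :
    ∀ᵐ ω ∂μ, IsTailNegligible (fun n => a n • z n ω) (runningNorm fun n => x n ω) := by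
  have hnegl := hz.ae_isTailNegligible ha (stronglyMeasurable_runningDeviation z)
    (monotone_runningDeviation z) (one_le_runningDeviation z)
    fun n => Eventually.of_forall (condExp_le_runningDeviation_sq z n)
  filter_upwards [hnegl, ae_all_iff.2 hK] with ω hω hKω
  exact hω.mono (by positivity) (runningDeviation_le hKω)

end MartingaleNoise

section MartingaleDifference

variable {d : ℕ} {Ω : Type*} [MeasurableSpace Ω] {μ : Measure Ω}
  {x₀ : Ω → EuclideanSpace ℝ (Fin d)} {M : ℕ → Ω → EuclideanSpace ℝ (Fin d)}

/-- The filtration `σ(x₀, M₁, …, Mₙ)` of a martingale difference sequence. -/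
def IsMartingaleDifference.filtration (hM : IsMartingaleDifference μ x₀ M) :
    Filtration ℕ ‹MeasurableSpace Ω› where
  seq := noiseSigma x₀ M
  mono' _ _ hij := sup_le_sup_left (biSup_mono fun _ hk => ⟨hk.1, hk.2.trans hij⟩) _
  le' n := by
    refine sup_le hM.measurable_init.comap_le (iSup₂_le fun i hi => ?_)
    obtain ⟨k, rfl⟩ := Nat.exists_eq_add_of_le' hi.1
    exact (hM.measurable k).comap_le

theorem IsMartingaleDifference.isMartingaleIncrement (hM : IsMartingaleDifference μ x₀ M) :
    IsMartingaleIncrement (fun n => M (n + 1)) hM.filtration μ where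
  stronglyMeasurable n := Measurable.stronglyMeasurable <| Measurable.of_comap_le <|
    le_sup_of_le_right <| le_iSup₂_of_le (n + 1) ⟨Nat.le_add_left 1 n, le_rfl⟩ le_rfl
  memLp := hM.memLp
  condExp_eq_zero := hM.condExp_eq_zero

end MartingaleDifference

/-! ### Almost sure boundedness -/

theorem theorem1_general {E Ω : Type*} [NormedAddCommGroup E] [NormedSpace ℝ E] [ProperSpace E]
    {m0 : MeasurableSpace Ω} {μ : Measure Ω} [IsFiniteMeasure μ] {ℱ : Filtration ℕ m0}
    {h G : E → Set E} {a : ℕ → ℝ} {x y z : ℕ → Ω → E}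
    (hrec : ∀ᵐ ω ∂μ, ∀ n, y n ω ∈ h (x n ω) ∧ x (n + 1) ω = x n ω + a n • (y n ω + z n ω))
    (hh : ∃ K : ℝ, ∀ u, ∀ w ∈ h u, ‖w‖ ≤ K * (1 + ‖u‖))
    (ha_pos : ∀ n, 0 < a n) (ha_sum : ¬ Summable a) (ha_sq : Summable fun n => a n ^ 2)
    (hz : IsMartingaleIncrement z ℱ μ)
    (hz_sq : ∃ K : ℝ, ∀ n,
      μ[fun ω => ‖z n ω‖ ^ 2 | ℱ n] ≤ᵐ[μ] fun ω => K * (1 + ‖x n ω‖ ^ 2))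
    (hG_convex : ∀ u, Convex ℝ (G u)) (hG_closed : ∀ u, IsClosed (G u))
    (hG : IsScalingLimit h G)
    (hG_attr : ∃ T : ℝ, 0 ≤ T ∧
      ∀ X, IsLipschitzTrajectory G X → ‖X 0‖ ≤ 1 → ‖X T‖ < 1) :
    ∀ᵐ ω ∂μ, BddAbove (Set.range fun n => ‖x n ω‖) := by
  obtain ⟨K, hK⟩ := hh
  obtain ⟨Kz, hKz⟩ := hz_sq
  obtain ⟨T, hT, hGT⟩ := hG_attr
  have hK' : ∀ u, ∀ w ∈ h u, ‖w‖ ≤ K.toNNReal * (1 + ‖u‖) := fun u w hw =>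
    (hK u w hw).trans (by gcongr; exact K.le_coe_toNNReal)
  have ha_zero : Tendsto a atTop (𝓝 0) := by
    simpa only [Real.sqrt_sq (ha_pos _).le, Real.sqrt_zero] using ha_sq.tendsto_atTop_zero.sqrt
  filter_upwards [hrec, hz.ae_isTailNegligible_runningNorm hKz ha_sq] with ω hω hnoise
  have H : IsPerturbedRecursion K.toNNReal a (fun n => x n ω) (fun n => y n ω)
      (fun n => a n • z n ω) :=
    { steps := ⟨ha_pos, ha_sum⟩
      tendsto_step := ha_zero
      succ := fun n => by rw [(hω n).2, smul_add, add_assoc]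
      norm_drift_le := fun n => hK' _ _ (hω n).1
      noise := hnoise }
  exact H.bddAbove_norm (fun n => (hω n).1) hK' hG_convex hG_closed hG hT hGT

theorem theorem1 {d : ℕ} {Ω : Type*} [MeasurableSpace Ω] (μ : Measure Ω) [IsProbabilityMeasure μ]
    (h : EuclideanSpace ℝ (Fin d) → Set (EuclideanSpace ℝ (Fin d)))
    (a : ℕ → ℝ) (x y M : ℕ → Ω → EuclideanSpace ℝ (Fin d))
    -- the stochastic recursive inclusion
    (hrec : ∀ᵐ ω ∂μ, ∀ n,
      y n ω ∈ h (x n ω) ∧ x (n + 1) ω = x n ω + a n • (y n ω + M (n + 1) ω))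
    -- the drift
    (hh : IsMarchaud h)
    -- the step sizes
    (ha_pos : ∀ n, 0 < a n) (ha_sum : ¬ Summable a) (ha_sq : Summable fun n => a n ^ 2)
    -- the noise
    (hM : IsMartingaleDifference μ (x 0) M)
    (hM_sq : ∃ K : ℝ, 0 < K ∧ ∀ n,
      μ[fun ω => ‖M (n + 1) ω‖ ^ 2 | noiseSigma (x 0) M n]
        ≤ᵐ[μ] fun ω => K * (1 + ‖x n ω‖ ^ 2))
    -- the limiting inclusion and its attracting set
    (h_nonempty : ∀ z, (limitMap h z).Nonempty)
    (h_attr : ∃ A U : Set (EuclideanSpace ℝ (Fin d)), IsAttractingSet (limitMap h) A U ∧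
      Metric.closedBall 0 1 ⊆ U ∧ A ⊆ Metric.ball 0 1)
    -- limits of rescaled selections
    (h_lim : ∀ (c : ℕ → ℕ) (u v : ℕ → EuclideanSpace ℝ (Fin d)) (p q : EuclideanSpace ℝ (Fin d)),
      (∀ n, 1 ≤ c n) → StrictMono c → Tendsto c atTop atTop →
      Tendsto u atTop (𝓝 p) → Tendsto v atTop (𝓝 q) →
      (∀ n, v n ∈ scaledMap h (c n : ℝ) (u n)) → q ∈ limitMap h p) :
    ∀ᵐ ω ∂μ, BddAbove (Set.range fun n => ‖x n ω‖) := by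
  obtain ⟨A, U, hAU, hU, hA⟩ := h_attr
  exact theorem1_general hrec (hh.bounded.imp fun K hK u w hw => (hK.2 u w hw).le) ha_pos ha_sum
    ha_sq hM.isMartingaleIncrement (hM_sq.imp fun _ hK => hK.2) (convex_limitMap hh.convex)
    (fun _ => isClosed_closure)
    (fun c u v p q hc1 hc => h_lim c u v p q hc1 hc hc.tendsto_atTop)
    ((hAU.exists_norm_lt_one hU hA).imp fun _ hT => ⟨hT.1, fun X hX => hT.2 X hX.isDISolution⟩)
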